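/- A *nondeterministic input-driven double-head pushdown automaton* is a system $M=\langle Q,\Sigma,\Gamma,q_0,F,\bot,\delta_D,\delta_R,\delta_N\rangle$ with a finite set of states $Q$, a finite input alphabet $\Sigma$ partitioned into $\Sigma_D,\Sigma_R,\Sigma_N$ (push, pop, state change only; parts may be empty), a finite pushdown alphabet $\Gamma$, an initial state $q_0\in Q$, accepting states $F\subseteq Q$, an empty-pushdown symbol $\bot\notin\Gamma$, and partial transition functions $\delta_D, \delta_R,\delta_N$. Here $\delta_X$ takes a state, a pair in $(\Sigma_X\cup\{\lambda\})^2$ in which exactly one component is the empty word $\lambda$, and an element of $\Gamma\cup\{\bot\}$; the values of $\delta_D$ are subsets of $Q\times\Gamma$, those of $\delta_R$ and $\delta_N$ are subsets of $Q$. A configuration is a triple $(q,w,s)\in Q\times\Sigma^*\times\Gamma^*$ (state, unread part of the input, pushdown content with its top at the left); let $z$ be the first symbol of $s$, or $\bot$ if $s=\lambda$. A step from $(q,aw,s)$ with the left head reading $a\in\Sigma$ leads to $(q',w,z's)$ if $a\in\Sigma_D$ and $(q',z')\in\delta_D(q,a,\lambda,z)$; to $(q',w,s')$ if $a\in\Sigma_R$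 and $q'\in\delta_R(q,a,\lambda,z)$, where $s'$ is $s$ without its first symbol ($s'=\lambda$ if $s=\lambda$); and to $(q',w,s)$ if $a\in\Sigma_N$ and $q'\in\delta_N(q,a,\lambda,z)$. A step from $(q,wa,s)$ with the right head reading $a$ is defined in the same way, with arguments $(q,\lambda,a,z)$. The language of $M$ is $$L(M)=\{\,w\in\Sigma^* \mid (q_0,w,\lambda)\vdash^*(q,\lambda,s)\text{ for some } q\in F,\ s\in\Gamma^*\,\}.$$ $M$ is *deterministic* (a DIDDHPDA) if in every configuration there is at most one choice of action (head to be moved together with the result of the transition). **Theorem.** Each of the following three problems is decidable, that is, it is solved by a single algorithm that works for all inputs. Given (finite descriptions of) a DIDDHPDA $M$ with input alphabet $\Sigma$, and a regular language $R\subseteq\Sigma^*$, presented by a deterministic finite automaton, decide whether 1. $L(M)=R$; 2. $R\subseteq L(M)$; 3. $L(M)\subseteq R$. -/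

import Mathlib

namespace IDDHPDA

/-- The two input heads: the left one moves to the right, the right one moves to the left. -/
inductive Head where
  | left
  | right

/-- What an input symbol does to the pushdown store: the three classes
`Σ_D` (push), `Σ_R` (pop) and `Σ_N` (state change only) of a signature. -/
inductive StackAction where
  | push
  | pop
  | neutral

/-- A nondeterministic input-driven double-head pushdown automaton with states `Q`, input
alphabet `S` and pushdown alphabet `Γ`. The signature is the map `sig`. In every transition exactly
one of the two heads reads a symbol, so the pair of input arguments (one of them the empty word) is
given as the moving head and the symbol it reads. The last argument is the top of the pushdown
store, `none` being the empty pushdown symbol `⊥`. An undefined value is the empty set. -/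
structure Automaton (Q S Γ : Type*) where
  sig : S → StackAction
  start : Q
  accept : Set Q
  pushTrans : Q → Head → {a : S // sig a = .push} → Option Γ → Set (Q × Γ)
  popTrans : Q → Head → {a : S // sig a = .pop} → Option Γ → Set Q
  neutralTrans : Q → Head → {a : S // sig a = .neutral} → Option Γ → Set Q

/-- A configuration: the current state, the unread part of the input, and the content of the
pushdown store (top first). -/
structure Config (Q S Γ : Type*) where
  state : Q
  unread : List S
  stack : List Γ

variable {Q S Γ P : Type*}

namespace Automaton

/-- `M.Step h c c'`: the automaton `M` can go from `c` to `c'` in one step that moves the head `h`.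
`s.head?` is the top of the pushdown store `s`, and `none` if `s` is empty; popping the empty store
leaves it empty. -/
inductive Step (M : Automaton Q S Γ) : Head → Config Q S Γ → Config Q S Γ → Prop
  | pushLeft (q q' : Q) (a : S) (w : List S) (s : List Γ) (z' : Γ) (ha : M.sig a = .push)
      (ht : (q', z') ∈ M.pushTrans q .left ⟨a, ha⟩ s.head?) :
      Step M .left ⟨q, a :: w, s⟩ ⟨q', w, z' :: s⟩
  | pushRight (q q' : Q) (a : S) (w : List S) (s : List Γ) (z' : Γ) (ha : M.sig a = .push)
      (ht : (q', z') ∈ M.pushTrans q .right ⟨a, ha⟩ s.head?) :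
      Step M .right ⟨q, w ++ [a], s⟩ ⟨q', w, z' :: s⟩
  | popLeft (q q' : Q) (a : S) (w : List S) (s : List Γ) (ha : M.sig a = .pop)
      (ht : q' ∈ M.popTrans q .left ⟨a, ha⟩ s.head?) :
      Step M .left ⟨q, a :: w, s⟩ ⟨q', w, s.tail⟩
  | popRight (q q' : Q) (a : S) (w : List S) (s : List Γ) (ha : M.sig a = .pop)
      (ht : q' ∈ M.popTrans q .right ⟨a, ha⟩ s.head?) :
      Step M .right ⟨q, w ++ [a], s⟩ ⟨q', w, s.tail⟩
  | neutralLeft (q q' : Q) (a : S) (w : List S) (s : List Γ) (ha : M.sig a = .neutral)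
      (ht : q' ∈ M.neutralTrans q .left ⟨a, ha⟩ s.head?) :
      Step M .left ⟨q, a :: w, s⟩ ⟨q', w, s⟩
  | neutralRight (q q' : Q) (a : S) (w : List S) (s : List Γ) (ha : M.sig a = .neutral)
      (ht : q' ∈ M.neutralTrans q .right ⟨a, ha⟩ s.head?) :
      Step M .right ⟨q, w ++ [a], s⟩ ⟨q', w, s⟩

/-- The words on which some computation from the initial configuration reads the whole input and
ends in an accepting state (with any pushdown content). -/
def language (M : Automaton Q S Γ) : Language S :=
  {w | ∃ q ∈ M.accept, ∃ s : List Γ,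
    Relation.ReflTransGen (fun c c' => ∃ h, M.Step h c c') ⟨M.start, w, []⟩ ⟨q, [], s⟩}

/-- Determinism: at most one choice of action in every configuration. The moving head together with
the successor configuration determines the transition that is applied. -/
def IsDeterministic (M : Automaton Q S Γ) : Prop :=
  ∀ (c c₁ c₂ : Config Q S Γ) (h₁ h₂ : Head),
    M.Step h₁ c c₁ → M.Step h₂ c c₂ → h₁ = h₂ ∧ c₁ = c₂

end Automaton

/-! ### Finite descriptions, the inputs of a decision procedure

`FinEnum X` is a finite type with an explicit numbering of its elements. -/

/-- The number of an element in the given enumeration. -/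
def num {X : Type*} [FinEnum X] (x : X) : ℕ := (FinEnum.equiv x : ℕ)

/-- `false` for the left head, `true` for the right head. -/
def Head.code : Head → Bool
  | .left => false
  | .right => true

/-- Push, pop and neutral are written `0`, `1`, `2`. -/
def StackAction.code : StackAction → ℕ
  | .push => 0
  | .pop => 1
  | .neutral => 2

/-- Both heads, as a list. -/
def heads : List Head := [.left, .right]

/-- All possible tops of the pushdown store, as a list. -/
def tops (Γ : Type*) [FinEnum Γ] : List (Option Γ) :=
  none :: (FinEnum.toList Γ).map some

/-- An entry `(q, h, a, z, r)` of a transition table: in state `q`, if the head `h` reads `a` and the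
top of the pushdown store is `z`, then `r` is a possible result. -/
abbrev TableEntry (R : Type) : Type := ℕ × Bool × ℕ × Option ℕ × R

/-- The description of an automaton: the numbers of states, of input symbols and of pushdown
symbols; the signature; the initial state; the accepting states; the tables of the
push, pop and neutral transitions. -/
abbrev AutomatonCode : Type :=
  ℕ × ℕ × ℕ × List ℕ × ℕ × List ℕ ×
    List (TableEntry (ℕ × ℕ)) × List (TableEntry ℕ) × List (TableEntry ℕ)

/-- The description of a deterministic finite automaton: the numbers of states and of input symbols,
the initial state, the accepting states, and the entries `(p, a, p')` of its transition table. -/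
abbrev DFACode : Type := ℕ × ℕ × ℕ × List ℕ × List (ℕ × ℕ × ℕ)

open Classical in
/-- The list of the numbers of the elements of a set. -/
noncomputable def listing {X : Type*} [FinEnum X] (A : Set X) : List ℕ :=
  ((FinEnum.toList X).filter (fun x => x ∈ A)).map num

namespace Automaton

variable [FinEnum Q] [FinEnum S] [FinEnum Γ]

open Classical in
/-- The table of the push transitions. -/
noncomputable def pushTable (M : Automaton Q S Γ) : List (TableEntry (ℕ × ℕ)) :=
  ((FinEnum.toList Q ×ˢ heads ×ˢ FinEnum.toList S ×ˢ tops Γ ×ˢ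
      FinEnum.toList Q ×ˢ FinEnum.toList Γ).filter
    (fun (q, h, a, z, q', z') =>
      ∃ ha : M.sig a = .push, (q', z') ∈ M.pushTrans q h ⟨a, ha⟩ z)).map
    (fun (q, h, a, z, q', z') => (num q, h.code, num a, z.map num, num q', num z'))

open Classical in
/-- The table of the pop transitions. -/
noncomputable def popTable (M : Automaton Q S Γ) : List (TableEntry ℕ) :=
  ((FinEnum.toList Q ×ˢ heads ×ˢ FinEnum.toList S ×ˢ tops Γ ×ˢ FinEnum.toList Q).filter
    (fun (q, h, a, z, q') => ∃ ha : M.sig a = .pop, q' ∈ M.popTrans q h ⟨a, ha⟩ z)).map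
    (fun (q, h, a, z, q') => (num q, h.code, num a, z.map num, num q'))

open Classical in
/-- The table of the neutral transitions. -/
noncomputable def neutralTable (M : Automaton Q S Γ) : List (TableEntry ℕ) :=
  ((FinEnum.toList Q ×ˢ heads ×ˢ FinEnum.toList S ×ˢ tops Γ ×ˢ FinEnum.toList Q).filter
    (fun (q, h, a, z, q') => ∃ ha : M.sig a = .neutral, q' ∈ M.neutralTrans q h ⟨a, ha⟩ z)).map
    (fun (q, h, a, z, q') => (num q, h.code, num a, z.map num, num q'))

/-- The description of an automaton by numbers and finite tables. -/
noncomputable def code (M : Automaton Q S Γ) : AutomatonCode :=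
  (FinEnum.card Q, FinEnum.card S, FinEnum.card Γ,
    (FinEnum.toList S).map (fun a => (M.sig a).code), num M.start, listing M.accept,
    M.pushTable, M.popTable, M.neutralTable)

end Automaton

/-- The description of a deterministic finite automaton by numbers and finite tables. -/
noncomputable def dfaCode [FinEnum S] [FinEnum P] (A : DFA S P) : DFACode :=
  (FinEnum.card P, FinEnum.card S, num A.start, listing A.accept,
    (FinEnum.toList P ×ˢ FinEnum.toList S).map (fun (p, a) => (num p, num a, num (A.step p a))))

/-- The question whether `Rel L(M) R` is decidable for deterministic input-driven double-head
pushdown automata `M` and regular languages `R` over the input alphabet of `M`, where `R` is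
given by a deterministic finite automaton: a single algorithm gives the right answer on (the
descriptions of) all such `M` and `R`. -/
def DecidableForRegular
    (Rel : ∀ {S : Type}, Language S → Language S → Prop) : Prop :=
  ∃ answer : AutomatonCode × DFACode → Prop, ComputablePred answer ∧
    ∀ (Q S Γ P : Type) [FinEnum Q] [FinEnum S] [FinEnum Γ] [FinEnum P]
      (M : Automaton Q S Γ) (A : DFA S P), M.IsDeterministic →
      (answer (M.code, dfaCode A) ↔ Rel M.language A.accepts)

end IDDHPDA

/-! Each problem reduces to a search for a counterexample: a word that lies in `R` and is rejected
by `M`, or lies outside `R` and is accepted. Since `M` is deterministic, a word is rejected exactly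
when its only maximal computation blocks too early or ends in a nonaccepting state.

The word is guessed from both ends inwards by a pushdown system without input, `Automaton.product`.
Besides the state of `M` it keeps a state `p` of the DFA, run forwards on the part read by the left
head, and a state `r`, run backwards on the part read by the right head. The first `r` is a guess of
the state reached on the whole word, and the guessed letters form a word with that outcome as soon
as `p = r`. If one head can move, determinism excludes every other move whatever the unread rest is,
so the rest need not be known. If both outer letters are blocked, the state of `M` becomes `none`
and the rest is discarded, in pairs of outer letters and possibly one single letter. The lemmas
`exists_word_of_steps` and `exists_steps_of_word` make this precise.

What remains is reachability of control states in a pushdown system. Computations that never go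
below a given top symbol are recorded as triples, the summaries, which are closed under a few local
rules (`exists_steps_iff_exists_summary`). There are finitely many triples, so iterating the rules
reaches the least fixed point in a bounded number of rounds, and the procedure is primitive
recursive in the descriptions. -/

namespace IDDHPDA

/-! ### Reachability in pushdown systems by summaries -/

/-- A pushdown system without input: control states `K`, pushdown symbols `Γ`. Every transition
depends on the top of the store, `none` being the top of the empty store. -/
structure PushdownSystem (K Γ : Type*) where
  neutral : K → Option Γ → K → Prop
  push : K → Option Γ → K → Γ → Prop
  pop : K → Option Γ → K → Prop

namespace PushdownSystem

variable {K Γ : Type*}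

/-- One step between configurations (control state, content of the store). -/
inductive Step (T : PushdownSystem K Γ) : K × List Γ → K × List Γ → Prop
  | neutral {c c' : K} {s : List Γ} (h : T.neutral c s.head? c') : Step T (c, s) (c', s)
  | push {c c' : K} {z : Γ} {s : List Γ} (h : T.push c s.head? c' z) : Step T (c, s) (c', z :: s)
  | pop {c c' : K} {s : List Γ} (h : T.pop c s.head? c') : Step T (c, s) (c', s.tail)

/-- Several steps. -/
abbrev Steps (T : PushdownSystem K Γ) : K × List Γ → K × List Γ → Prop :=
  Relation.ReflTransGen T.Step

/-- `Summary T I c z c'`: a configuration with control state `c` and top `z` is reachable from an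
initial one, entered by a push of `z` if `z ≠ none`, and from there a computation that only works
above this `z` leads to the control state `c'` and the same store. -/
inductive Summary (T : PushdownSystem K Γ) (I : K → Prop) : K → Option Γ → K → Prop
  | init {c : K} (h : I c) : Summary T I c none c
  | enter {c c' d : K} {z : Option Γ} {z' : Γ} (h : Summary T I c z c') (hp : T.push c' z d z') :
      Summary T I d (some z') d
  | neutral {c c' d : K} {z : Option Γ} (h : Summary T I c z c') (hn : T.neutral c' z d) :
      Summary T I c z d
  | popEmpty {c c' d : K} (h : Summary T I c none c') (hp : T.pop c' none d) :
      Summary T I c none d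
  | pushPop {c c' d d' e : K} {z : Option Γ} {z' : Γ} (h : Summary T I c z c')
      (hp : T.push c' z d z') (h' : Summary T I d (some z') d') (hq : T.pop d' (some z') e) :
      Summary T I c z e

variable {T : PushdownSystem K Γ} {I : K → Prop}

/-- `Supported T I c s`: the store `s` was built by pushes of the computations that the summaries
describe, the last of which led to the control state `c`. -/
inductive Supported (T : PushdownSystem K Γ) (I : K → Prop) : K → List Γ → Prop
  | nil (c : K) : Supported T I c []
  | cons {c c' d : K} {s : List Γ} {z : Γ} (hs : Supported T I c s)
      (h : Summary T I c s.head? c') (hp : T.push c' s.head? d z) : Supported T I d (z :: s)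

/-- The first half must hold for every store with top `z`: in `pushPop` the inner summary may have
been derived in another context, and it is reused above the current store. This is sound because
transitions see only the top. -/
theorem Summary.steps {c c' : K} {z : Option Γ} (h : Summary T I c z c') :
    (∀ s : List Γ, s.head? = z → T.Steps (c, s) (c', s)) ∧
      ∃ c₀, I c₀ ∧ ∃ s : List Γ, s.head? = z ∧ T.Steps (c₀, []) (c, s) := by
  induction h with
  | init h => exact ⟨fun s _ => .refl, _, h, [], rfl, .refl⟩
  | enter h hp ih =>
    obtain ⟨h₁, c₀, hc₀, s, rfl, h₂⟩ := ih
    exact ⟨fun s _ => .refl, c₀, hc₀, _ :: s, rfl, (h₂.trans (h₁ s rfl)).tail (.push hp)⟩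
  | neutral h hn ih =>
    refine ⟨fun s hs => (ih.1 s hs).tail (.neutral (hs ▸ hn)), ih.2⟩
  | popEmpty h hp ih =>
    refine ⟨fun s hs => ?_, ih.2⟩
    obtain rfl : s = [] := List.head?_eq_none_iff.1 hs
    exact (ih.1 [] rfl).tail (.pop (s := []) hp)
  | pushPop h hp h' hq ih ih' =>
    refine ⟨fun s hs => ?_, ih.2⟩
    exact (((ih.1 s hs).tail (.push (hs ▸ hp))).trans (ih'.1 (_ :: s) rfl)).tail
      (.pop (s := _ :: s) hq)

/-- A summary describes only the topmost level of the store. `Supported` keeps the levels below, so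
that a pop can be matched with the push it undoes. -/
theorem exists_summary_of_steps {c₀ : K} (h₀ : I c₀) {x : K × List Γ}
    (h : T.Steps (c₀, []) x) : ∃ c, Summary T I c x.2.head? x.1 ∧ Supported T I c x.2 := by
  induction h with
  | refl => exact ⟨c₀, .init h₀, .nil _⟩
  | tail _ hstep ih =>
    obtain ⟨c, hc, hs⟩ := ih
    cases hstep with
    | neutral h => exact ⟨c, .neutral hc h, hs⟩
    | push h => exact ⟨_, .enter hc h, .cons hs hc h⟩
    | pop h =>
      cases hs with
      | nil => exact ⟨c, .popEmpty hc h, .nil _⟩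
      -- The summary `h₁` of the level below is resumed and prolonged by the completed excursion.
      | cons hs h₁ hp => exact ⟨_, .pushPop h₁ hp hc h, hs⟩

/-- The control states of the reachable configurations are those at the end of a summary. -/
theorem exists_steps_iff_exists_summary (c' : K) :
    (∃ c₀, I c₀ ∧ ∃ s, T.Steps (c₀, []) (c', s)) ↔ ∃ c z, Summary T I c z c' := by
  constructor
  · rintro ⟨c₀, h₀, s, h⟩
    obtain ⟨c, hc, -⟩ := exists_summary_of_steps h₀ h
    exact ⟨c, _, hc⟩
  · rintro ⟨c, z, h⟩
    obtain ⟨h₁, c₀, h₀, s, hs, h₂⟩ := h.steps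
    exact ⟨c₀, h₀, s, h₂.trans (h₁ s hs)⟩

end PushdownSystem

/-! ### Least fixed points in a finite universe -/

section Closure

variable {α β : Type*}

open Classical in
/-- The elements of the list `U` that follow from those of `X` by the rule `R`. -/
noncomputable def consequences (U : List β) (R : List β → β → Prop) (X : List β) : List β :=
  U.filter (fun b => R X b)

/-- The elements of the finite universe `U` that are derivable by the monotone rule `R`. -/
noncomputable def derivable (U : List β) (R : List β → β → Prop) : List β :=
  (consequences U R)^[U.length] []

/-- Leastness: it gives soundness of the derived elements and needs no monotonicity. -/
theorem derivable_induction {U : List β} {R : List β → β → Prop} {p : β → Prop}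
    (h : ∀ X b, (∀ x ∈ X, p x) → b ∈ U → R X b → p b) : ∀ b ∈ derivable U R, p b := by
  unfold derivable
  induction U.length with
  | zero => simp
  | succ n ih =>
    rw [Function.iterate_succ_apply']
    intro b hb
    simp only [consequences, List.mem_filter, decide_eq_true_eq] at hb
    exact h _ b ih hb.1 hb.2

/-- From the empty list on, the rounds form an increasing chain of sublists. A round that changes
anything adds an element, so at most `U.length` rounds do. -/
theorem consequences_derivable {U : List β} {R : List β → β → Prop}
    (hR : ∀ X Y b, X ⊆ Y → R X b → R Y b) :
    consequences U R (derivable U R) = derivable U R := by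
  have mono : ∀ {X Y : List β}, X ⊆ Y → (consequences U R X).Sublist (consequences U R Y) :=
    fun h => List.monotone_filter_right _ fun b hb => by
      simp only [decide_eq_true_eq] at hb ⊢
      exact hR _ _ b h hb
  have incr : ∀ n, ((consequences U R)^[n] []).Sublist ((consequences U R)^[n + 1] []) := by
    intro n
    induction n with
    | zero => simp
    | succ n ih =>
      rw [Function.iterate_succ_apply' _ n, Function.iterate_succ_apply' _ (n + 1)]
      exact mono ih.subset
  -- Once stationary, the chain stays so; otherwise every round so far has added at least one
  -- element.
  have grow : ∀ n, (consequences U R)^[n + 1] [] = (consequences U R)^[n] [] ∨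
      n + 1 ≤ ((consequences U R)^[n + 1] []).length := by
    intro n
    induction n with
    | zero =>
      rcases Nat.eq_zero_or_pos ((consequences U R)^[0 + 1] []).length with h | h
      · exact .inl (by simpa using h)
      · exact .inr h
    | succ n ih =>
      rcases ih with ih | ih
      · left
        rw [Function.iterate_succ_apply' _ (n + 1), ih,
          ← Function.iterate_succ_apply' (consequences U R) n []]
        exact ih
      · rcases (incr (n + 1)).length_le.eq_or_lt with h | h
        · exact .inl ((incr (n + 1)).eq_of_length h).symm
        · exact .inr (by omega)
  have bound : ((consequences U R)^[U.length + 1] []).length ≤ U.length := by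
    rw [Function.iterate_succ_apply']
    exact List.length_filter_le _ _
  have := (grow U.length).resolve_right (by omega)
  rwa [Function.iterate_succ_apply'] at this

theorem mem_derivable_iff {U : List β} {R : List β → β → Prop}
    (hR : ∀ X Y b, X ⊆ Y → R X b → R Y b) {b : β} :
    b ∈ derivable U R ↔ b ∈ U ∧ R (derivable U R) b := by
  conv_lhs => rw [← consequences_derivable hR]
  simp [consequences]

variable [Primcodable α] [Primcodable β]

/-- The classical filter is harmless: for a primitive recursive rule it agrees with a primitive
recursive filter, iterated a primitive recursive number of times. -/
theorem primrec_derivable {U : α → List β} {R : α → List β → β → Prop} (hU : Primrec U)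
    (hR : PrimrecPred fun x : (α × List β) × β => R x.1.1 x.1.2 x.2) :
    Primrec fun a => derivable (U a) (R a) := by
  classical
  refine Primrec.nat_iterate (Primrec.list_length.comp hU) (Primrec.const []) ?_
  have h : PrimrecRel fun (b : β) (x : α × List β) => R x.1 x.2 b :=
    hR.comp (Primrec.pair Primrec.snd Primrec.fst)
  refine ((PrimrecRel.listFilter h).comp (hU.comp Primrec.fst) Primrec.id).of_eq fun x => ?_
  simp [consequences]

end Closure

theorem primrecPred_exists_mem {α β : Type*} [Primcodable α] [Primcodable β] {f : α → List β}
    {p : α → β → Prop} (hf : Primrec f) (hp : PrimrecPred fun x : α × β => p x.1 x.2) :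
    PrimrecPred fun a => ∃ b ∈ f a, p a b := by
  have h : PrimrecRel fun (b : β) (a : α) => p a b :=
    hp.comp (Primrec.pair Primrec.snd Primrec.fst)
  exact h.exists_mem_list.comp hf Primrec.id

theorem primrecPred_mem {α β : Type*} [Primcodable α] [Primcodable β] {f : α → β}
    {g : α → List β} (hf : Primrec f) (hg : Primrec g) : PrimrecPred fun a => f a ∈ g a :=
  (primrecPred_exists_mem hg (p := fun a b => b = f a)
    (Primrec.eq.comp Primrec.snd (hf.comp Primrec.fst))).of_eq fun a => by simp

/-! ### The decision procedure on numerical descriptions -/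

/-- Descriptions of control states of the product of an automaton and a deterministic finite
automaton: `(q, p, r)` stands for the state `q` of the former, the state `p` that the latter reaches
on the part read by the left head, and the state `r` from which the part read by the right head
leads to the end. The number of states takes the place of `q` once the automaton is stuck. -/
abbrev ControlCode : Type := ℕ × ℕ × ℕ

/-- Descriptions of summaries. -/
abbrev SummaryCode : Type := ControlCode × Option ℕ × ControlCode

/-- In the transition table `T`, the head `h` can read `a` and change the pair of states `k` to
`k'`. -/
def TableHeadMove (T : List (ℕ × ℕ × ℕ)) (h : Bool) (a : ℕ) (k k' : ℕ × ℕ) : Prop :=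
  (h = false ∧ (k.1, a, k'.1) ∈ T ∧ k'.2 = k.2) ∨ (h = true ∧ (k'.2, a, k.2) ∈ T ∧ k'.1 = k.1)

/-- The table `tab` has an entry with result `r` that applies to `c` and top `z` and changes the
pair of states of the finite automaton to `k'`. -/
def TableMove {R : Type} (tab : List (TableEntry R)) (T : List (ℕ × ℕ × ℕ)) (c : ControlCode)
    (z : Option ℕ) (r : R) (k' : ℕ × ℕ) : Prop :=
  ∃ e ∈ tab, e.1 = c.1 ∧ e.2.2.2.1 = z ∧ e.2.2.2.2 = r ∧ TableHeadMove T e.2.1 e.2.2.1 c.2 k'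

/-- The table `tab` has an entry for the state `q`, the head `h`, the symbol `a` and the top `z`. -/
def TableEnabled {R : Type} (tab : List (TableEntry R)) (q : ℕ) (h : Bool) (a : ℕ)
    (z : Option ℕ) : Prop :=
  ∃ e ∈ tab, e.1 = q ∧ e.2.1 = h ∧ e.2.2.1 = a ∧ e.2.2.2.1 = z

namespace AutomatonCode

/-- The number of states. -/
def card (C : AutomatonCode) : ℕ := C.1
/-- The number of pushdown symbols. -/
def cardStack (C : AutomatonCode) : ℕ := C.2.2.1
/-- The initial state. -/
def start (C : AutomatonCode) : ℕ := C.2.2.2.2.1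
/-- The accepting states. -/
def accept (C : AutomatonCode) : List ℕ := C.2.2.2.2.2.1
/-- The table of push transitions. -/
def pushTable (C : AutomatonCode) : List (TableEntry (ℕ × ℕ)) := C.2.2.2.2.2.2.1
/-- The table of pop transitions. -/
def popTable (C : AutomatonCode) : List (TableEntry ℕ) := C.2.2.2.2.2.2.2.1
/-- The table of neutral transitions. -/
def neutralTable (C : AutomatonCode) : List (TableEntry ℕ) := C.2.2.2.2.2.2.2.2

/-- No transition applies. -/
def Blocked (C : AutomatonCode) (q : ℕ) (h : Bool) (a : ℕ) (z : Option ℕ) : Prop :=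
  ¬ TableEnabled C.pushTable q h a z ∧ ¬ TableEnabled C.popTable q h a z ∧
    ¬ TableEnabled C.neutralTable q h a z

end AutomatonCode

namespace DFACode

/-- The number of states. -/
def card (D : DFACode) : ℕ := D.1
/-- The initial state. -/
def start (D : DFACode) : ℕ := D.2.2.1
/-- The accepting states. -/
def accept (D : DFACode) : List ℕ := D.2.2.2.1
/-- The transition table. -/
def table (D : DFACode) : List (ℕ × ℕ × ℕ) := D.2.2.2.2

end DFACode

/-- Moves from `c` with top `z` to the control state `c'` because neither the first nor the last
symbol of the unread part can be read. -/
def CodeStuck (x : AutomatonCode × DFACode) (c : ControlCode) (z : Option ℕ)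
    (c' : ControlCode) : Prop :=
  c'.1 = x.1.card ∧ ∃ t ∈ x.2.table, t.1 = c.2.1 ∧ t.2.2 = c'.2.1 ∧
    x.1.Blocked c.1 false t.2.1 z ∧
      ((x.1.Blocked c.1 true t.2.1 z ∧ c'.2.1 = c.2.2 ∧ c'.2.2 = c.2.2) ∨
        ∃ t' ∈ x.2.table, t'.1 = c'.2.2 ∧ t'.2.2 = c.2.2 ∧ x.1.Blocked c.1 true t'.2.1 z)

/-- The product of an automaton and a deterministic finite automaton, on descriptions. -/
def codeSystem (x : AutomatonCode × DFACode) : PushdownSystem ControlCode ℕ where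
  neutral c z c' := TableMove x.1.neutralTable x.2.table c z c'.1 c'.2 ∨ CodeStuck x c z c'
  push c z c' z' := TableMove x.1.pushTable x.2.table c z (c'.1, z') c'.2
  pop c z c' := TableMove x.1.popTable x.2.table c z c'.1 c'.2

/-- Initial control states for the words of the regular language (`b = true`), or for the others. -/
def CodeInitial (b : Bool) (x : AutomatonCode × DFACode) (c : ControlCode) : Prop :=
  c.1 = x.1.start ∧ c.2.1 = x.2.start ∧ (c.2.2 ∈ x.2.accept ↔ b = true)

/-- Control states at the end of a computation on a word that is not accepted (`b = true`), or
accepted. -/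
def CodeFinal (b : Bool) (x : AutomatonCode × DFACode) (c : ControlCode) : Prop :=
  c.2.1 = c.2.2 ∧ (c.1 ∈ x.1.accept ↔ ¬ b = true)

/-- The rules for summaries, on descriptions. -/
def CodeRule (b : Bool) (x : AutomatonCode × DFACode) (X : List SummaryCode)
    (y : SummaryCode) : Prop :=
  (y.1 = y.2.2 ∧ y.2.1 = none ∧ CodeInitial b x y.1) ∨
  (y.1 = y.2.2 ∧ ∃ u ∈ X, ∃ z' ∈ y.2.1, (codeSystem x).push u.2.2 u.2.1 y.1 z') ∨
  (∃ u ∈ X, u.1 = y.1 ∧ u.2.1 = y.2.1 ∧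
    ((codeSystem x).neutral u.2.2 y.2.1 y.2.2 ∨
      (y.2.1 = none ∧ (codeSystem x).pop u.2.2 none y.2.2) ∨
      ∃ v ∈ X, (codeSystem x).pop v.2.2 v.2.1 y.2.2 ∧
        ∃ z' ∈ v.2.1, (codeSystem x).push u.2.2 y.2.1 v.1 z'))

/-- The control states of the product. -/
def controlUniverse (x : AutomatonCode × DFACode) : List ControlCode :=
  List.range (x.1.card + 1) ×ˢ List.range x.2.card ×ˢ List.range x.2.card

/-- The possible tops of the store. -/
def topUniverse (x : AutomatonCode × DFACode) : List (Option ℕ) :=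
  none :: (List.range x.1.cardStack).map some

/-- The possible summaries. -/
def summaryUniverse (x : AutomatonCode × DFACode) : List SummaryCode :=
  controlUniverse x ×ˢ topUniverse x ×ˢ controlUniverse x

/-- The summaries that are derivable from the initial control states. -/
noncomputable def codeSummaries (b : Bool) (x : AutomatonCode × DFACode) : List SummaryCode :=
  derivable (summaryUniverse x) (CodeRule b x)

/-- There is a word in the regular language that the automaton does not accept (`b = true`), or
conversely. -/
def CodeDiffers (b : Bool) (x : AutomatonCode × DFACode) : Prop :=
  ∃ y ∈ codeSummaries b x, CodeFinal b x y.2.2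

/-! ### The procedure is primitive recursive -/

section Primrec

open Primrec

variable {α R : Type} [Primcodable α] [Primcodable R]

theorem primrecPred_tableHeadMove {T : α → List (ℕ × ℕ × ℕ)} {h : α → Bool} {a : α → ℕ}
    {k k' : α → ℕ × ℕ} (hT : Primrec T) (hh : Primrec h) (ha : Primrec a) (hk : Primrec k)
    (hk' : Primrec k') :
    PrimrecPred fun x => TableHeadMove (T x) (h x) (a x) (k x) (k' x) :=
  ((Primrec.eq.comp hh (const false)).and
    ((primrecPred_mem ((fst.comp hk).pair (ha.pair (fst.comp hk'))) hT).and
      (Primrec.eq.comp (snd.comp hk') (snd.comp hk)))).or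
  ((Primrec.eq.comp hh (const true)).and
    ((primrecPred_mem ((snd.comp hk').pair (ha.pair (snd.comp hk))) hT).and
      (Primrec.eq.comp (fst.comp hk') (fst.comp hk))))

theorem primrecPred_tableMove {tab : α → List (TableEntry R)} {T : α → List (ℕ × ℕ × ℕ)}
    {c : α → ControlCode} {z : α → Option ℕ} {r : α → R} {k' : α → ℕ × ℕ}
    (htab : Primrec tab) (hT : Primrec T) (hc : Primrec c) (hz : Primrec z) (hr : Primrec r)
    (hk' : Primrec k') :
    PrimrecPred fun x => TableMove (tab x) (T x) (c x) (z x) (r x) (k' x) := by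
  have e₁ : Primrec fun u : α × TableEntry R => u.2.2 := snd.comp snd
  have e₂ : Primrec fun u : α × TableEntry R => u.2.2.2 := snd.comp e₁
  have e₃ : Primrec fun u : α × TableEntry R => u.2.2.2.2 := snd.comp e₂
  exact primrecPred_exists_mem htab <|
    (Primrec.eq.comp (fst.comp snd) (fst.comp (hc.comp fst))).and <|
    (Primrec.eq.comp (fst.comp e₃) (hz.comp fst)).and <|
    (Primrec.eq.comp (snd.comp e₃) (hr.comp fst)).and <|
    primrecPred_tableHeadMove (hT.comp fst) (fst.comp e₁) (fst.comp e₂)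
      (snd.comp (hc.comp fst)) (hk'.comp fst)

theorem primrecPred_tableEnabled {tab : α → List (TableEntry R)} {q : α → ℕ} {h : α → Bool}
    {a : α → ℕ} {z : α → Option ℕ} (htab : Primrec tab) (hq : Primrec q) (hh : Primrec h)
    (ha : Primrec a) (hz : Primrec z) :
    PrimrecPred fun x => TableEnabled (tab x) (q x) (h x) (a x) (z x) := by
  have e₁ : Primrec fun u : α × TableEntry R => u.2.2 := snd.comp snd
  have e₂ : Primrec fun u : α × TableEntry R => u.2.2.2 := snd.comp e₁
  have e₃ : Primrec fun u : α × TableEntry R => u.2.2.2.2 := snd.comp e₂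
  exact primrecPred_exists_mem htab <|
    (Primrec.eq.comp (fst.comp snd) (hq.comp fst)).and <|
    (Primrec.eq.comp (fst.comp e₁) (hh.comp fst)).and <|
    (Primrec.eq.comp (fst.comp e₂) (ha.comp fst)).and <|
    Primrec.eq.comp (fst.comp e₃) (hz.comp fst)

theorem primrec_card : Primrec AutomatonCode.card := fst

theorem primrec_cardStack : Primrec AutomatonCode.cardStack := fst.comp (snd.comp snd)

theorem primrec_start : Primrec AutomatonCode.start :=
  fst.comp (snd.comp (snd.comp (snd.comp snd)))

theorem primrec_accept : Primrec AutomatonCode.accept :=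
  fst.comp (snd.comp (snd.comp (snd.comp (snd.comp snd))))

theorem primrec_pushTable : Primrec AutomatonCode.pushTable :=
  fst.comp (snd.comp (snd.comp (snd.comp (snd.comp (snd.comp snd)))))

theorem primrec_popTable : Primrec AutomatonCode.popTable :=
  fst.comp (snd.comp (snd.comp (snd.comp (snd.comp (snd.comp (snd.comp snd))))))

theorem primrec_neutralTable : Primrec AutomatonCode.neutralTable :=
  snd.comp (snd.comp (snd.comp (snd.comp (snd.comp (snd.comp (snd.comp snd))))))

theorem primrec_dfaCard : Primrec DFACode.card := fst

theorem primrec_dfaStart : Primrec DFACode.start := fst.comp (snd.comp snd)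

theorem primrec_dfaAccept : Primrec DFACode.accept := fst.comp (snd.comp (snd.comp snd))

theorem primrec_dfaTable : Primrec DFACode.table := snd.comp (snd.comp (snd.comp snd))

theorem primrecPred_blocked {C : α → AutomatonCode} {q : α → ℕ} {h : α → Bool} {a : α → ℕ}
    {z : α → Option ℕ} (hC : Primrec C) (hq : Primrec q) (hh : Primrec h) (ha : Primrec a)
    (hz : Primrec z) : PrimrecPred fun x => (C x).Blocked (q x) (h x) (a x) (z x) :=
  (primrecPred_tableEnabled (primrec_pushTable.comp hC) hq hh ha hz).not.and <|
    (primrecPred_tableEnabled (primrec_popTable.comp hC) hq hh ha hz).not.and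
      (primrecPred_tableEnabled (primrec_neutralTable.comp hC) hq hh ha hz).not

variable {x : α → AutomatonCode × DFACode} {c c' : α → ControlCode} {z : α → Option ℕ}

theorem primrecPred_codeStuck (hx : Primrec x) (hc : Primrec c) (hz : Primrec z)
    (hc' : Primrec c') : PrimrecPred fun i => CodeStuck (x i) (c i) (z i) (c' i) := by
  have hT := primrec_dfaTable.comp (snd.comp hx)
  have hC := fst.comp hx
  have hp := fst.comp (snd.comp hc)
  have hr := snd.comp (snd.comp hc)
  have hp' := fst.comp (snd.comp hc')
  have hr' := snd.comp (snd.comp hc')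
  have ht : Primrec fun u : α × ℕ × ℕ × ℕ => u.2.2.1 := fst.comp (snd.comp snd)
  have ht' : Primrec fun u : (α × ℕ × ℕ × ℕ) × ℕ × ℕ × ℕ => u.2.2.1 := fst.comp (snd.comp snd)
  refine (Primrec.eq.comp (fst.comp hc') (primrec_card.comp hC)).and <|
    primrecPred_exists_mem hT <|
    (Primrec.eq.comp (fst.comp snd) (hp.comp fst)).and <|
    (Primrec.eq.comp (snd.comp (snd.comp snd)) (hp'.comp fst)).and <|
    (primrecPred_blocked (hC.comp fst) ((fst.comp hc).comp fst) (const false) ht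
      (hz.comp fst)).and <|
    ((primrecPred_blocked (hC.comp fst) ((fst.comp hc).comp fst) (const true) ht
      (hz.comp fst)).and <| (Primrec.eq.comp (hp'.comp fst) (hr.comp fst)).and <|
      Primrec.eq.comp (hr'.comp fst) (hr.comp fst)).or ?_
  exact primrecPred_exists_mem (hT.comp fst) <|
    (Primrec.eq.comp (fst.comp snd) ((hr'.comp fst).comp fst)).and <|
    (Primrec.eq.comp (snd.comp (snd.comp snd)) ((hr.comp fst).comp fst)).and <|
    primrecPred_blocked ((hC.comp fst).comp fst) (((fst.comp hc).comp fst).comp fst) (const true)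
      ht' ((hz.comp fst).comp fst)

theorem primrecPred_neutral (hx : Primrec x) (hc : Primrec c) (hz : Primrec z)
    (hc' : Primrec c') : PrimrecPred fun i => (codeSystem (x i)).neutral (c i) (z i) (c' i) :=
  (primrecPred_tableMove (primrec_neutralTable.comp (fst.comp hx))
    (primrec_dfaTable.comp (snd.comp hx)) hc hz (fst.comp hc') (snd.comp hc')).or
    (primrecPred_codeStuck hx hc hz hc')

theorem primrecPred_push {z' : α → ℕ} (hx : Primrec x) (hc : Primrec c) (hz : Primrec z)
    (hc' : Primrec c') (hz' : Primrec z') :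
    PrimrecPred fun i => (codeSystem (x i)).push (c i) (z i) (c' i) (z' i) :=
  primrecPred_tableMove (primrec_pushTable.comp (fst.comp hx))
    (primrec_dfaTable.comp (snd.comp hx)) hc hz ((fst.comp hc').pair hz') (snd.comp hc')

theorem primrecPred_pop (hx : Primrec x) (hc : Primrec c) (hz : Primrec z)
    (hc' : Primrec c') : PrimrecPred fun i => (codeSystem (x i)).pop (c i) (z i) (c' i) :=
  primrecPred_tableMove (primrec_popTable.comp (fst.comp hx))
    (primrec_dfaTable.comp (snd.comp hx)) hc hz (fst.comp hc') (snd.comp hc')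

/-- Here `q` does not depend on the input, so a case distinction outside the algorithm suffices. It
is applied to the fixed flag `b`. -/
theorem PrimrecPred.iff_const {p : α → Prop} (hp : PrimrecPred p) (q : Prop) :
    PrimrecPred fun i => p i ↔ q := by
  by_cases hq : q
  · exact hp.of_eq fun i => by simp [hq]
  · exact hp.not.of_eq fun i => by simp [hq]

theorem primrecPred_codeInitial (b : Bool) (hx : Primrec x) (hc : Primrec c) :
    PrimrecPred fun i => CodeInitial b (x i) (c i) :=
  (Primrec.eq.comp (fst.comp hc) (primrec_start.comp (fst.comp hx))).and <|
    (Primrec.eq.comp (fst.comp (snd.comp hc)) (primrec_dfaStart.comp (snd.comp hx))).and <|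
    PrimrecPred.iff_const
      (primrecPred_mem (snd.comp (snd.comp hc)) (primrec_dfaAccept.comp (snd.comp hx))) _

theorem primrecPred_codeFinal (b : Bool) (hx : Primrec x) (hc : Primrec c) :
    PrimrecPred fun i => CodeFinal b (x i) (c i) :=
  (Primrec.eq.comp (fst.comp (snd.comp hc)) (snd.comp (snd.comp hc))).and <|
    PrimrecPred.iff_const (primrecPred_mem (fst.comp hc) (primrec_accept.comp (fst.comp hx))) _

theorem primrecPred_exists_mem_option {β : Type} [Primcodable β] {f : α → Option β}
    {p : α → β → Prop} (hf : Primrec f) (hp : PrimrecPred fun u : α × β => p u.1 u.2) :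
    PrimrecPred fun i => ∃ b ∈ f i, p i b :=
  (primrecPred_exists_mem (Primrec.optionToList.comp hf) hp).of_eq fun i => by simp

theorem primrecPred_codeRule (b : Bool) {X : α → List SummaryCode} {y : α → SummaryCode}
    (hx : Primrec x) (hX : Primrec X) (hy : Primrec y) :
    PrimrecPred fun i => CodeRule b (x i) (X i) (y i) := by
  have h₁ := fst.comp hy
  have hz := fst.comp (snd.comp hy)
  have h₂ := snd.comp (snd.comp hy)
  have u₁ : Primrec fun u : α × SummaryCode => u.2.1 := fst.comp snd
  have uz : Primrec fun u : α × SummaryCode => u.2.2.1 := fst.comp (snd.comp snd)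
  have u₂ : Primrec fun u : α × SummaryCode => u.2.2.2 := snd.comp (snd.comp snd)
  have v₁ : Primrec fun v : (α × SummaryCode) × SummaryCode => v.2.1 := fst.comp snd
  have vz : Primrec fun v : (α × SummaryCode) × SummaryCode => v.2.2.1 := fst.comp (snd.comp snd)
  have v₂ : Primrec fun v : (α × SummaryCode) × SummaryCode => v.2.2.2 := snd.comp (snd.comp snd)
  refine ((Primrec.eq.comp h₁ h₂).and
    ((Primrec.eq.comp hz (const none)).and (primrecPred_codeInitial b hx h₁))).or <|
    ((Primrec.eq.comp h₁ h₂).and ?_).or ?_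
  · exact primrecPred_exists_mem hX <| primrecPred_exists_mem_option (hz.comp fst) <|
      primrecPred_push ((hx.comp fst).comp fst) (u₂.comp fst) (uz.comp fst)
        ((h₁.comp fst).comp fst) snd
  · refine primrecPred_exists_mem hX <| (Primrec.eq.comp u₁ (h₁.comp fst)).and <|
      (Primrec.eq.comp uz (hz.comp fst)).and <|
      (primrecPred_neutral (hx.comp fst) u₂ (hz.comp fst) (h₂.comp fst)).or <|
      ((Primrec.eq.comp (hz.comp fst) (const none)).and
        (primrecPred_pop (hx.comp fst) u₂ (const none) (h₂.comp fst))).or ?_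
    exact primrecPred_exists_mem (hX.comp fst) <|
      (primrecPred_pop ((hx.comp fst).comp fst) v₂ vz ((h₂.comp fst).comp fst)).and <|
      primrecPred_exists_mem_option vz <|
      primrecPred_push (((hx.comp fst).comp fst).comp fst) ((u₂.comp fst).comp fst)
        (((hz.comp fst).comp fst).comp fst) (v₁.comp fst) snd

theorem primrec_list_product {β γ : Type} [Primcodable β] [Primcodable γ] {f : α → List β}
    {g : α → List γ} (hf : Primrec f) (hg : Primrec g) : Primrec fun i => f i ×ˢ g i :=
  list_flatMap hf <| Primrec.to₂ <| list_map (hg.comp fst) <| Primrec.to₂ <|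
    (snd.comp fst).pair snd

theorem primrec_controlUniverse (hx : Primrec x) : Primrec fun i => controlUniverse (x i) := by
  have hP := list_range.comp (primrec_dfaCard.comp (snd.comp hx))
  exact primrec_list_product (list_range.comp (succ.comp (primrec_card.comp (fst.comp hx))))
    (primrec_list_product hP hP)

theorem primrec_topUniverse (hx : Primrec x) : Primrec fun i => topUniverse (x i) :=
  list_cons.comp (const none) <|
    list_map (list_range.comp (primrec_cardStack.comp (fst.comp hx))) (option_some.comp snd).to₂

theorem primrec_summaryUniverse (hx : Primrec x) : Primrec fun i => summaryUniverse (x i) :=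
  primrec_list_product (primrec_controlUniverse hx)
    (primrec_list_product (primrec_topUniverse hx) (primrec_controlUniverse hx))

theorem primrecPred_codeDiffers_comp (b : Bool) (hx : Primrec x) :
    PrimrecPred fun i => CodeDiffers b (x i) :=
  primrecPred_exists_mem (primrec_derivable (primrec_summaryUniverse hx)
    (primrecPred_codeRule b (hx.comp (fst.comp fst)) (snd.comp fst) snd))
    (primrecPred_codeFinal b (hx.comp fst) (snd.comp (snd.comp snd)))

theorem primrecPred_codeDiffers (b : Bool) : PrimrecPred (CodeDiffers b) :=
  primrecPred_codeDiffers_comp b Primrec.id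

end Primrec

/-! ### The product of the automaton and the DFA -/

variable {Q S Γ P : Type}

/-- The head `h` can read `a` and change the pair `k` of states of `A` (the state reached on the
part read by the left head, the state from which the part read by the right head leads to the end)
to `k'`. -/
def HeadMove (A : DFA S P) : Head → S → P × P → P × P → Prop
  | .left, a, k, k' => A.step k.1 a = k'.1 ∧ k'.2 = k.2
  | .right, a, k, k' => A.step k'.2 a = k.2 ∧ k'.1 = k.1

/-- A transition of the relation `rel` with result `x` applies to `c` and the top `z` and changes
the pair of states of `A` to `k'`. -/
def RelMove {X : Type} (A : DFA S P) (rel : Q → Head → S → Option Γ → X → Prop)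
    (c : Option Q × P × P) (z : Option Γ) (x : X) (k' : P × P) : Prop :=
  ∃ q h a, c.1 = some q ∧ rel q h a z x ∧ HeadMove A h a c.2 k'

namespace Automaton

variable (M : Automaton Q S Γ)

/-- The push transitions as a relation. -/
def PushRel (q : Q) (h : Head) (a : S) (z : Option Γ) (x : Q × Γ) : Prop :=
  ∃ ha : M.sig a = .push, x ∈ M.pushTrans q h ⟨a, ha⟩ z

/-- The pop transitions as a relation. -/
def PopRel (q : Q) (h : Head) (a : S) (z : Option Γ) (q' : Q) : Prop :=
  ∃ ha : M.sig a = .pop, q' ∈ M.popTrans q h ⟨a, ha⟩ z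

/-- The neutral transitions as a relation. -/
def NeutralRel (q : Q) (h : Head) (a : S) (z : Option Γ) (q' : Q) : Prop :=
  ∃ ha : M.sig a = .neutral, q' ∈ M.neutralTrans q h ⟨a, ha⟩ z

/-- Some transition of the head `h` reading `a` applies; none does if there is no state. -/
def Enabled (o : Option Q) (h : Head) (a : S) (z : Option Γ) : Prop :=
  ∃ q, o = some q ∧
    ((∃ x, M.PushRel q h a z x) ∨ (∃ x, M.PopRel q h a z x) ∨ ∃ x, M.NeutralRel q h a z x)

/-- Moves from `c` with top `z` to the control state `c'` because neither the first nor the last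
symbol of the unread part can be read. They are removed, possibly as a single symbol that ends the
word. -/
def Stuck (A : DFA S P) (c : Option Q × P × P) (z : Option Γ) (c' : Option Q × P × P) : Prop :=
  c'.1 = none ∧ ∃ a, A.step c.2.1 a = c'.2.1 ∧ ¬ M.Enabled c.1 .left a z ∧
    ((¬ M.Enabled c.1 .right a z ∧ c'.2.1 = c.2.2 ∧ c'.2.2 = c.2.2) ∨
      ∃ a', A.step c'.2.2 a' = c.2.2 ∧ ¬ M.Enabled c.1 .right a' z)

/-- The product of `M` and `A`. It guesses the symbols that `M` reads. -/
def product (A : DFA S P) : PushdownSystem (Option Q × P × P) Γ where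
  neutral c z c' := (∃ q', c'.1 = some q' ∧ RelMove A M.NeutralRel c z q' c'.2) ∨ M.Stuck A c z c'
  push c z c' z' := ∃ q', c'.1 = some q' ∧ RelMove A M.PushRel c z (q', z') c'.2
  pop c z c' := ∃ q', c'.1 = some q' ∧ RelMove A M.PopRel c z q' c'.2

/-- Initial control states for the words of the language of `A` (`b = true`), or for the others. -/
def ProductInitial (b : Bool) (A : DFA S P) (c : Option Q × P × P) : Prop :=
  c.1 = some M.start ∧ c.2.1 = A.start ∧ (c.2.2 ∈ A.accept ↔ b = true)

/-- There is an accepting state in `o`. -/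
def AcceptingState (o : Option Q) : Prop := ∃ q ∈ M.accept, o = some q

end Automaton

/-! ### Numbering of states and symbols -/

section Numbering

variable [FinEnum Q] [FinEnum S] [FinEnum Γ] [FinEnum P]

theorem num_injective {X : Type} [FinEnum X] : Function.Injective (num (X := X)) :=
  fun _ _ h => FinEnum.equiv.injective (Fin.ext h)

theorem num_lt {X : Type} [FinEnum X] (x : X) : num x < FinEnum.card X := (FinEnum.equiv x).2

theorem exists_num_eq {X : Type} [FinEnum X] {n : ℕ} (h : n < FinEnum.card X) :
    ∃ x : X, num x = n := ⟨FinEnum.equiv.symm ⟨n, h⟩, by simp [num]⟩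

theorem mem_listing {X : Type} [FinEnum X] {A : Set X} {n : ℕ} :
    n ∈ listing A ↔ ∃ x ∈ A, num x = n := by simp [listing]

theorem Head.code_injective : Function.Injective Head.code := by
  intro h h'
  cases h <;> cases h' <;> simp [Head.code]

theorem map_num_injective {X : Type} [FinEnum X] :
    Function.Injective (Option.map (num (X := X))) := Option.map_injective num_injective

theorem mem_heads (h : Head) : h ∈ heads := by cases h <;> simp [heads]

theorem mem_tops (z : Option Γ) : z ∈ tops Γ := by cases z <;> simp [tops]

/-- The number of a state, and the number of states in place of a missing state. -/
def stateNum : Option Q → ℕ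
  | none => FinEnum.card Q
  | some q => num q

theorem stateNum_eq_num {o : Option Q} {q : Q} : stateNum o = num q ↔ o = some q := by
  cases o with
  | none => simpa [stateNum] using (num_lt q).ne'
  | some q' => simp [stateNum, num_injective.eq_iff]

theorem stateNum_eq_card {o : Option Q} : stateNum o = FinEnum.card Q ↔ o = none := by
  cases o with
  | none => simp [stateNum]
  | some q' => simpa [stateNum] using (num_lt q').ne

/-- The description of a control state of the product. -/
def controlNum (c : Option Q × P × P) : ControlCode := (stateNum c.1, num c.2.1, num c.2.2)

theorem controlNum_injective : Function.Injective (controlNum (Q := Q) (P := P)) := by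
  rintro ⟨o, p, r⟩ ⟨o', p', r'⟩ h
  simp only [controlNum, Prod.mk.injEq, num_injective.eq_iff] at h
  obtain ⟨h, rfl, rfl⟩ := h
  cases o' with
  | none => rw [stateNum_eq_card.1 h]
  | some q => rw [stateNum_eq_num.1 h]

/-- The description of a summary. -/
def summaryNum (y : (Option Q × P × P) × Option Γ × (Option Q × P × P)) : SummaryCode :=
  (controlNum y.1, y.2.1.map num, controlNum y.2.2)

theorem mem_dfaTable {A : DFA S P} {t : ℕ × ℕ × ℕ} :
    t ∈ (dfaCode A).table ↔ ∃ p a, t = (num p, num a, num (A.step p a)) := by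
  simp [dfaCode, DFACode.table, List.mem_map, List.product, SProd.sprod, eq_comm]

end Numbering

/-! ### The descriptions simulate the product -/

section Correspondence

variable [FinEnum Q] [FinEnum S] [FinEnum Γ] [FinEnum P]

/-- The entry of a transition table for a transition with result number `r`. -/
def tableEntry {R : Type} (q : Q) (h : Head) (a : S) (z : Option Γ) (r : R) : TableEntry R :=
  (num q, h.code, num a, z.map num, r)

theorem Automaton.mem_pushTable {M : Automaton Q S Γ} {e : TableEntry (ℕ × ℕ)} :
    e ∈ AutomatonCode.pushTable M.code ↔
      ∃ q h a z x, M.PushRel q h a z x ∧ e = tableEntry q h a z (num x.1, num x.2) := by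
  simp [AutomatonCode.pushTable, Automaton.code, Automaton.pushTable, List.mem_map, mem_heads,
    mem_tops, tableEntry, PushRel, eq_comm]

theorem Automaton.mem_popTable {M : Automaton Q S Γ} {e : TableEntry ℕ} :
    e ∈ AutomatonCode.popTable M.code ↔
      ∃ q h a z x, M.PopRel q h a z x ∧ e = tableEntry q h a z (num x) := by
  simp [AutomatonCode.popTable, Automaton.code, Automaton.popTable, List.mem_map, mem_heads,
    mem_tops, tableEntry, PopRel, eq_comm]

theorem Automaton.mem_neutralTable {M : Automaton Q S Γ} {e : TableEntry ℕ} :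
    e ∈ AutomatonCode.neutralTable M.code ↔
      ∃ q h a z x, M.NeutralRel q h a z x ∧ e = tableEntry q h a z (num x) := by
  simp [AutomatonCode.neutralTable, Automaton.code, Automaton.neutralTable, List.mem_map,
    mem_heads, mem_tops, tableEntry, NeutralRel, eq_comm]

theorem tableHeadMove_iff {A : DFA S P} {h : Head} {a : S} {k k' : P × P} :
    TableHeadMove (dfaCode A).table h.code (num a) (num k.1, num k.2) (num k'.1, num k'.2) ↔
      HeadMove A h a k k' := by
  cases h <;> simp [TableHeadMove, HeadMove, Head.code, mem_dfaTable, num_injective.eq_iff, eq_comm]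

section Table

variable {X R : Type} {rel : Q → Head → S → Option Γ → X → Prop} {f : X → R}
  {tab : List (TableEntry R)}

/-- Stated for an arbitrary relation and an arbitrary encoding `f` of results, so that it serves
push transitions, whose results are pairs, as well as pop and neutral ones. -/
theorem tableMove_iff
    (htab : ∀ e, e ∈ tab ↔ ∃ q h a z x, rel q h a z x ∧ e = tableEntry q h a z (f x))
    {A : DFA S P} {c : Option Q × P × P} {z : Option Γ} {r : R} {k' : P × P} :
    TableMove tab (dfaCode A).table (controlNum c) (z.map num) r (num k'.1, num k'.2) ↔
      ∃ x, r = f x ∧ RelMove A rel c z x k' := by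
  constructor
  · rintro ⟨e, he, h₁, h₂, h₃, h₄⟩
    obtain ⟨q, h, a, z', x, hrel, rfl⟩ := (htab _).1 he
    obtain rfl := map_num_injective h₂
    exact ⟨x, h₃.symm, q, h, a, stateNum_eq_num.1 h₁.symm, hrel, tableHeadMove_iff.1 h₄⟩
  · rintro ⟨x, rfl, q, h, a, h₁, hrel, hm⟩
    exact ⟨_, (htab _).2 ⟨q, h, a, z, x, hrel, rfl⟩, (stateNum_eq_num.2 h₁).symm, rfl, rfl,
      tableHeadMove_iff.2 hm⟩

theorem tableEnabled_iff
    (htab : ∀ e, e ∈ tab ↔ ∃ q h a z x, rel q h a z x ∧ e = tableEntry q h a z (f x))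
    {o : Option Q} {h : Head} {a : S} {z : Option Γ} :
    TableEnabled tab (stateNum o) h.code (num a) (z.map num) ↔
      ∃ q, o = some q ∧ ∃ x, rel q h a z x := by
  constructor
  · rintro ⟨e, he, h₁, h₂, h₃, h₄⟩
    obtain ⟨q, h, a, z', x, hrel, rfl⟩ := (htab _).1 he
    obtain rfl := map_num_injective h₄
    obtain rfl := num_injective h₃
    obtain rfl := Head.code_injective h₂
    exact ⟨q, stateNum_eq_num.1 h₁.symm, x, hrel⟩
  · rintro ⟨q, rfl, x, hrel⟩
    exact ⟨_, (htab _).2 ⟨q, h, a, z, x, hrel, rfl⟩, rfl, rfl, rfl, rfl⟩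

end Table

section System

variable {M : Automaton Q S Γ} {A : DFA S P} {b : Bool} {c c' : Option Q × P × P} {z : Option Γ}

/-- For `o = none` both sides are true: no table entry has the number of states as its state. -/
theorem blocked_iff {o : Option Q} {h : Head} {a : S} :
    AutomatonCode.Blocked M.code (stateNum o) h.code (num a) (z.map num) ↔
      ¬ M.Enabled o h a z := by
  rw [AutomatonCode.Blocked, tableEnabled_iff fun _ => M.mem_pushTable,
    tableEnabled_iff fun _ => M.mem_popTable, tableEnabled_iff fun _ => M.mem_neutralTable,
    Automaton.Enabled, ← not_or, ← not_or, ← exists_or, ← exists_or]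
  simp only [and_or_left]

theorem codeStuck_iff :
    CodeStuck (M.code, dfaCode A) (controlNum c) (z.map num) (controlNum c') ↔
      M.Stuck A c z c' := by
  have hcard : AutomatonCode.card M.code = FinEnum.card Q := rfl
  have hl := fun a => blocked_iff (M := M) (z := z) (o := c.1) (h := .left) (a := a)
  have hr := fun a => blocked_iff (M := M) (z := z) (o := c.1) (h := .right) (a := a)
  simp only [Head.code] at hl hr
  simp only [CodeStuck, Automaton.Stuck, controlNum, hcard, stateNum_eq_card]
  refine and_congr_right fun _ => ⟨?_, ?_⟩
  · rintro ⟨t, ht, h₁, h₂, h₃, h₄⟩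
    obtain ⟨p, a, rfl⟩ := mem_dfaTable.1 ht
    obtain rfl := num_injective h₁
    refine ⟨a, num_injective h₂, (hl a).1 h₃, h₄.imp (And.imp (hr a).1 (And.imp (@num_injective _ _ _ _) (@num_injective _ _ _ _))) ?_⟩
    rintro ⟨t', ht', h₅, h₆, h₇⟩
    obtain ⟨p', a', rfl⟩ := mem_dfaTable.1 ht'
    obtain rfl := num_injective h₅
    exact ⟨a', num_injective h₆, (hr a').1 h₇⟩
  · rintro ⟨a, h₁, h₂, h₃⟩
    refine ⟨_, mem_dfaTable.2 ⟨c.2.1, a, rfl⟩, rfl, congrArg num h₁, (hl a).2 h₂,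
      h₃.imp (And.imp (hr a).2 (And.imp (congrArg num) (congrArg num))) ?_⟩
    rintro ⟨a', h₄, h₅⟩
    exact ⟨_, mem_dfaTable.2 ⟨c'.2.2, a', rfl⟩, rfl, congrArg num h₄, (hr a').2 h₅⟩

theorem codeSystem_neutral_iff :
    (codeSystem (M.code, dfaCode A)).neutral (controlNum c) (z.map num) (controlNum c') ↔
      (M.product A).neutral c z c' := by
  refine or_congr ((tableMove_iff fun _ => M.mem_neutralTable).trans ?_) codeStuck_iff
  exact exists_congr fun q => and_congr_left fun _ => stateNum_eq_num

theorem codeSystem_pop_iff :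
    (codeSystem (M.code, dfaCode A)).pop (controlNum c) (z.map num) (controlNum c') ↔
      (M.product A).pop c z c' := by
  refine (tableMove_iff fun _ => M.mem_popTable).trans ?_
  exact exists_congr fun q => and_congr_left fun _ => stateNum_eq_num

theorem codeSystem_push_iff {z' : Γ} :
    (codeSystem (M.code, dfaCode A)).push (controlNum c) (z.map num) (controlNum c') (num z') ↔
      (M.product A).push c z c' z' := by
  refine (tableMove_iff (f := fun x : Q × Γ => (num x.1, num x.2))
    fun _ => M.mem_pushTable).trans ⟨?_, ?_⟩
  · rintro ⟨x, hx, h⟩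
    simp only [Prod.mk.injEq] at hx
    obtain rfl := num_injective hx.2
    exact ⟨x.1, stateNum_eq_num.1 hx.1, h⟩
  · rintro ⟨q, hq, h⟩
    exact ⟨(q, z'), by simp only [Prod.mk.injEq, and_true]; exact stateNum_eq_num.2 hq, h⟩

theorem codeInitial_iff :
    CodeInitial b (M.code, dfaCode A) (controlNum c) ↔ M.ProductInitial b A c := by
  have h₁ : AutomatonCode.start M.code = num M.start := rfl
  have h₂ : (dfaCode A).start = num A.start := rfl
  have h₃ : (dfaCode A).accept = listing A.accept := rfl
  simp [CodeInitial, Automaton.ProductInitial, controlNum, h₁, h₂, h₃, stateNum_eq_num,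
    num_injective.eq_iff, mem_listing]

theorem codeFinal_iff :
    CodeFinal b (M.code, dfaCode A) (controlNum c) ↔
      c.2.1 = c.2.2 ∧ (M.AcceptingState c.1 ↔ ¬ b = true) := by
  have h₁ : AutomatonCode.accept M.code = listing M.accept := rfl
  have h₂ : (∃ q ∈ M.accept, num q = stateNum c.1) ↔ M.AcceptingState c.1 :=
    exists_congr fun q => and_congr_right fun _ => eq_comm.trans stateNum_eq_num
  simp only [CodeFinal, controlNum, h₁, mem_listing, h₂, num_injective.eq_iff]

theorem mem_controlUniverse {y : ControlCode} :
    y ∈ controlUniverse (M.code, dfaCode A) ↔ ∃ c : Option Q × P × P, controlNum c = y := by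
  have h₁ : AutomatonCode.card M.code = FinEnum.card Q := rfl
  have h₂ : (dfaCode A).card = FinEnum.card P := rfl
  obtain ⟨n, p, r⟩ := y
  simp only [controlUniverse, h₁, h₂, List.mem_product, List.mem_range]
  constructor
  · rintro ⟨hn, hp, hr⟩
    obtain ⟨p, rfl⟩ := exists_num_eq hp
    obtain ⟨r, rfl⟩ := exists_num_eq hr
    -- The extra value, equal to the number of states, encodes `none`.
    rcases (Nat.le_of_lt_succ hn).eq_or_lt with rfl | hn
    · exact ⟨(none, p, r), rfl⟩
    · obtain ⟨q, rfl⟩ := exists_num_eq hn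
      exact ⟨(some q, p, r), rfl⟩
  · rintro ⟨⟨o, p', r'⟩, h⟩
    simp only [controlNum, Prod.mk.injEq] at h
    obtain ⟨rfl, rfl, rfl⟩ := h
    refine ⟨?_, num_lt _, num_lt _⟩
    cases o with
    | none => simp [stateNum]
    | some q => exact (num_lt q).trans (Nat.lt_succ_self _)

theorem mem_topUniverse {y : Option ℕ} :
    y ∈ topUniverse (M.code, dfaCode A) ↔ ∃ z : Option Γ, z.map num = y := by
  have h₁ : AutomatonCode.cardStack M.code = FinEnum.card Γ := rfl
  simp only [topUniverse, h₁, List.mem_cons, List.mem_map, List.mem_range]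
  constructor
  · rintro (rfl | ⟨n, hn, rfl⟩)
    · exact ⟨none, rfl⟩
    · obtain ⟨z, rfl⟩ := exists_num_eq hn
      exact ⟨some z, rfl⟩
  · rintro ⟨z | z, rfl⟩
    · exact .inl rfl
    · exact .inr ⟨num z, num_lt z, rfl⟩

theorem mem_summaryUniverse {y : SummaryCode} :
    y ∈ summaryUniverse (M.code, dfaCode A) ↔
      ∃ u : (Option Q × P × P) × Option Γ × (Option Q × P × P), summaryNum u = y := by
  obtain ⟨c, z, c'⟩ := y
  simp only [summaryUniverse, List.mem_product, mem_controlUniverse, mem_topUniverse]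
  constructor
  · rintro ⟨⟨c, rfl⟩, ⟨z, rfl⟩, c', rfl⟩
    exact ⟨(c, z, c'), rfl⟩
  · rintro ⟨⟨d, z', d'⟩, h⟩
    simp only [summaryNum, Prod.mk.injEq] at h
    exact ⟨⟨d, h.1⟩, ⟨z', h.2.1⟩, d', h.2.2⟩

theorem codeRule_mono {x : AutomatonCode × DFACode} (X Y : List SummaryCode) (y : SummaryCode)
    (h : X ⊆ Y) : CodeRule b x X y → CodeRule b x Y y := by
  rintro (h₁ | ⟨h₁, u, hu, h₂⟩ | ⟨u, hu, h₁, h₂, h₃⟩)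
  · exact .inl h₁
  · exact .inr (.inl ⟨h₁, u, h hu, h₂⟩)
  · refine .inr (.inr ⟨u, h hu, h₁, h₂, h₃.imp_right (.imp_right ?_)⟩)
    rintro ⟨v, hv, h₄⟩
    exact ⟨v, h hv, h₄⟩

/-- Soundness, by leastness. Membership in the universe guarantees that every derived triple of
numbers is the code of an actual triple. -/
theorem summary_of_mem_codeSummaries {y : SummaryCode}
    (h : y ∈ codeSummaries b (M.code, dfaCode A)) :
    ∃ c z c', y = summaryNum (c, z, c') ∧
      (M.product A).Summary (M.ProductInitial b A) c z c' := by
  refine derivable_induction (p := fun y => ∃ c z c', y = summaryNum (c, z, c') ∧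
      (M.product A).Summary (M.ProductInitial b A) c z c') ?_ y h
  intro X y hX hy hR
  obtain ⟨⟨c, z, c'⟩, rfl⟩ := mem_summaryUniverse.1 hy
  refine ⟨c, z, c', rfl, ?_⟩
  rcases hR with ⟨h₁, h₂, h₃⟩ | ⟨h₁, u, hu, n, hn, h₂⟩ | ⟨u, hu, h₁, h₂, h₃⟩
  · obtain rfl : c = c' := controlNum_injective h₁
    obtain rfl : z = none := by simpa [summaryNum] using h₂
    exact .init (codeInitial_iff.1 h₃)
  · obtain rfl : c = c' := controlNum_injective h₁
    obtain ⟨d, z', d', rfl, hs⟩ := hX u hu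
    obtain ⟨z, rfl, rfl⟩ : ∃ z₀, z = some z₀ ∧ num z₀ = n := by simpa [summaryNum] using hn
    exact .enter hs (codeSystem_push_iff.1 h₂)
  · obtain ⟨d, z', d', rfl, hs⟩ := hX u hu
    obtain rfl := controlNum_injective h₁
    obtain rfl := map_num_injective h₂
    rcases h₃ with h₃ | ⟨h₃, h₄⟩ | ⟨v, hv, h₃, n, hn, h₄⟩
    · exact .neutral hs (codeSystem_neutral_iff.1 h₃)
    · obtain rfl : z' = none := by simpa [summaryNum] using h₃
      exact .popEmpty hs (codeSystem_pop_iff.1 h₄)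
    · obtain ⟨e, z, e', rfl, hs'⟩ := hX v hv
      obtain ⟨z, rfl, rfl⟩ : ∃ z₀, z = some z₀ ∧ num z₀ = n := by simpa [summaryNum] using hn
      exact .pushPop hs (codeSystem_push_iff.1 h₄) hs' (codeSystem_pop_iff.1 h₃)

/-- Completeness: the derivable list is closed under the rules, and each constructor of `Summary` is
one case of `CodeRule`. -/
theorem mem_codeSummaries_of_summary
    (h : (M.product A).Summary (M.ProductInitial b A) c z c') :
    summaryNum (c, z, c') ∈ codeSummaries b (M.code, dfaCode A) := by
  have key : ∀ {c z c'}, CodeRule b (M.code, dfaCode A) (codeSummaries b (M.code, dfaCode A))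
      (summaryNum (c, z, c')) → summaryNum (c, z, c') ∈ codeSummaries b (M.code, dfaCode A) :=
    fun h => (mem_derivable_iff codeRule_mono).2 ⟨mem_summaryUniverse.2 ⟨_, rfl⟩, h⟩
  induction h with
  | init h => exact key (.inl ⟨rfl, rfl, codeInitial_iff.2 h⟩)
  | enter h hp ih => exact key (.inr (.inl ⟨rfl, _, ih, _, rfl, codeSystem_push_iff.2 hp⟩))
  | neutral h hn ih =>
    exact key (.inr (.inr ⟨_, ih, rfl, rfl, .inl (codeSystem_neutral_iff.2 hn)⟩))
  | popEmpty h hp ih =>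
    exact key (.inr (.inr ⟨_, ih, rfl, rfl, .inr (.inl ⟨rfl, codeSystem_pop_iff.2 hp⟩)⟩))
  | pushPop h hp h' hq ih ih' =>
    exact key (.inr (.inr ⟨_, ih, rfl, rfl, .inr (.inr ⟨_, ih', codeSystem_pop_iff.2 hq, _, rfl,
      codeSystem_push_iff.2 hp⟩)⟩))

theorem codeDiffers_iff :
    CodeDiffers b (M.code, dfaCode A) ↔ ∃ c₀, M.ProductInitial b A c₀ ∧ ∃ c s,
      (M.product A).Steps (c₀, []) (c, s) ∧
        c.2.1 = c.2.2 ∧ (M.AcceptingState c.1 ↔ ¬ b = true) := by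
  constructor
  · rintro ⟨y, hy, hf⟩
    obtain ⟨c, z, c', rfl, hs⟩ := summary_of_mem_codeSummaries hy
    obtain ⟨c₀, h₀, s, h⟩ :=
      (PushdownSystem.exists_steps_iff_exists_summary c').2 ⟨c, z, hs⟩
    exact ⟨c₀, h₀, c', s, h, codeFinal_iff.1 hf⟩
  · rintro ⟨c₀, h₀, c', s, h, hf⟩
    obtain ⟨c, z, hs⟩ := (PushdownSystem.exists_steps_iff_exists_summary c').1 ⟨c₀, h₀, s, h⟩
    exact ⟨_, mem_codeSummaries_of_summary hs, codeFinal_iff.2 hf⟩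

end System

end Correspondence

/-! ### Words and computations of the product -/

/-- If the head `h` reads `a` from `w`, then `w'` remains. -/
def Head.Reads : Head → S → List S → List S → Prop
  | .left, a, w, w' => w = a :: w'
  | .right, a, w, w' => w = w' ++ [a]

namespace Automaton

variable {M : Automaton Q S Γ}

/-- The effect on state and store when the head `h` reads `a`. -/
def Act (M : Automaton Q S Γ) (q : Q) (h : Head) (a : S) (s : List Γ) (q' : Q)
    (s' : List Γ) : Prop :=
  (∃ z, M.PushRel q h a s.head? (q', z) ∧ s' = z :: s) ∨
    (M.PopRel q h a s.head? q' ∧ s' = s.tail) ∨ (M.NeutralRel q h a s.head? q' ∧ s' = s)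

theorem step_iff {h : Head} {c c' : Config Q S Γ} :
    M.Step h c c' ↔
      ∃ a, h.Reads a c.unread c'.unread ∧ M.Act c.state h a c.stack c'.state c'.stack := by
  constructor
  · intro h
    cases h with
    | pushLeft q q' a w s z' ha ht => exact ⟨a, rfl, .inl ⟨z', ⟨ha, ht⟩, rfl⟩⟩
    | pushRight q q' a w s z' ha ht => exact ⟨a, rfl, .inl ⟨z', ⟨ha, ht⟩, rfl⟩⟩
    | popLeft q q' a w s ha ht => exact ⟨a, rfl, .inr (.inl ⟨⟨ha, ht⟩, rfl⟩)⟩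
    | popRight q q' a w s ha ht => exact ⟨a, rfl, .inr (.inl ⟨⟨ha, ht⟩, rfl⟩)⟩
    | neutralLeft q q' a w s ha ht => exact ⟨a, rfl, .inr (.inr ⟨⟨ha, ht⟩, rfl⟩)⟩
    | neutralRight q q' a w s ha ht => exact ⟨a, rfl, .inr (.inr ⟨⟨ha, ht⟩, rfl⟩)⟩
  · obtain ⟨q, w, s⟩ := c
    obtain ⟨q', w', s'⟩ := c'
    rintro ⟨a, hr, hact⟩
    cases h <;> simp only [Head.Reads] at hr <;> subst hr <;>
      rcases hact with ⟨z, ⟨ha, ht⟩, hs⟩ | ⟨⟨ha, ht⟩, hs⟩ | ⟨⟨ha, ht⟩, hs⟩ <;>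
      simp only at hs <;> subst hs
    · exact .pushLeft _ _ _ _ _ _ ha ht
    · exact .popLeft _ _ _ _ _ ha ht
    · exact .neutralLeft _ _ _ _ _ ha ht
    · exact .pushRight _ _ _ _ _ _ ha ht
    · exact .popRight _ _ _ _ _ ha ht
    · exact .neutralRight _ _ _ _ _ ha ht

theorem enabled_some_iff {q : Q} {h : Head} {a : S} {s : List Γ} :
    M.Enabled (some q) h a s.head? ↔ ∃ q' s', M.Act q h a s q' s' := by
  constructor
  · rintro ⟨_, ⟨⟩, ⟨⟨q', z⟩, h⟩ | ⟨q', h⟩ | ⟨q', h⟩⟩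
    · exact ⟨q', _, .inl ⟨z, h, rfl⟩⟩
    · exact ⟨q', _, .inr (.inl ⟨h, rfl⟩)⟩
    · exact ⟨q', _, .inr (.inr ⟨h, rfl⟩)⟩
  · rintro ⟨q', s', ⟨z, h, -⟩ | ⟨h, -⟩ | ⟨h, -⟩⟩
    · exact ⟨q, rfl, .inl ⟨_, h⟩⟩
    · exact ⟨q, rfl, .inr (.inl ⟨_, h⟩)⟩
    · exact ⟨q, rfl, .inr (.inr ⟨_, h⟩)⟩

/-- An accepting computation starts in the configuration `(q, w, s)` with `o = some q`. -/
def AcceptsFrom (M : Automaton Q S Γ) (o : Option Q) (w : List S) (s : List Γ) : Prop :=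
  ∃ q, o = some q ∧ ∃ q' ∈ M.accept, ∃ s' : List Γ,
    Relation.ReflTransGen (fun c c' => ∃ h, M.Step h c c') ⟨q, w, s⟩ ⟨q', [], s'⟩

/-- This is where determinism enters: an accepting computation must begin with the given step. The
product may therefore follow one possible move without examining the other head. -/
theorem acceptsFrom_iff_of_step (hM : M.IsDeterministic) {h : Head} {q q' : Q} {w w' : List S}
    {s s' : List Γ} (hs : M.Step h ⟨q, w, s⟩ ⟨q', w', s'⟩) :
    M.AcceptsFrom (some q) w s ↔ M.AcceptsFrom (some q') w' s' := by
  constructor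
  · rintro ⟨_, ⟨⟩, f, hf, t, hr⟩
    refine ⟨q', rfl, f, hf, t, ?_⟩
    -- The computation is not empty, since the given step reads a letter of `w`.
    rcases hr.cases_head with heq | ⟨c, ⟨h', hs'⟩, hr⟩
    · obtain ⟨a, hr, -⟩ := step_iff.1 hs
      cases heq
      cases h <;> simp [Head.Reads] at hr
    · obtain ⟨-, rfl⟩ := hM _ _ _ _ _ hs hs'
      exact hr
  · rintro ⟨_, ⟨⟩, f, hf, t, hr⟩
    exact ⟨q, rfl, f, hf, t, .head ⟨h, hs⟩ hr⟩

theorem acceptsFrom_nil_iff {o : Option Q} {s : List Γ} :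
    M.AcceptsFrom o [] s ↔ M.AcceptingState o := by
  constructor
  · rintro ⟨q, rfl, f, hf, t, hr⟩
    rcases hr.cases_head with heq | ⟨c, ⟨h, hs⟩, -⟩
    · cases heq
      exact ⟨q, hf, rfl⟩
    · obtain ⟨a, hr, -⟩ := step_iff.1 hs
      cases h <;> simp [Head.Reads] at hr
  · rintro ⟨q, hq, rfl⟩
    exact ⟨q, rfl, q, hq, s, .refl⟩

/-- Neither head can read: the first symbol of `w` is blocked for the left head, and the last one
for the right head. -/
theorem not_acceptsFrom_of_blocked {o : Option Q} {w : List S} {s : List Γ} (hw : w ≠ [])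
    (h : ∀ h a w', Head.Reads h a w w' → ¬ M.Enabled o h a s.head?) : ¬ M.AcceptsFrom o w s := by
  rintro ⟨q, rfl, f, hf, t, hr⟩
  rcases hr.cases_head with heq | ⟨c, ⟨h', hs⟩, -⟩
  · cases heq
    exact hw rfl
  · obtain ⟨a, hr, hact⟩ := step_iff.1 hs
    exact h h' a _ hr (enabled_some_iff.2 ⟨_, _, hact⟩)

end Automaton

/-- Undoing a move puts the letter back at the end where the head read it, so the word grows
outwards from its middle. -/
theorem HeadMove.exists_reads {A : DFA S P} {h : Head} {a : S} {k k' : P × P}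
    (hm : HeadMove A h a k k') {w' : List S} (hw' : A.evalFrom k'.1 w' = k'.2) :
    ∃ w, h.Reads a w w' ∧ A.evalFrom k.1 w = k.2 := by
  cases h with
  | left => exact ⟨a :: w', rfl, by rw [DFA.evalFrom_cons, hm.1, hw', hm.2]⟩
  | right => exact ⟨w' ++ [a], rfl, by rw [DFA.evalFrom_append_singleton, ← hm.2, hw', hm.1]⟩

theorem Head.Reads.exists_headMove {A : DFA S P} {h : Head} {a : S} {k : P × P} {w w' : List S}
    (hr : h.Reads a w w') (hw : A.evalFrom k.1 w = k.2) :
    ∃ k', HeadMove A h a k k' ∧ A.evalFrom k'.1 w' = k'.2 := by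
  cases h with
  | left =>
    subst hr
    exact ⟨(A.step k.1 a, k.2), ⟨rfl, rfl⟩, by rwa [DFA.evalFrom_cons] at hw⟩
  | right =>
    subst hr
    exact ⟨(k.1, A.evalFrom k.1 w'), ⟨by rwa [DFA.evalFrom_append_singleton] at hw, rfl⟩, rfl⟩

namespace Automaton

variable {M : Automaton Q S Γ} {A : DFA S P}

theorem product_step_of_act {h : Head} {a : S} {q q' : Q} {s s' : List Γ} {k k' : P × P}
    (hact : M.Act q h a s q' s') (hm : HeadMove A h a k k') :
    (M.product A).Step ((some q, k), s) ((some q', k'), s') := by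
  rcases hact with ⟨z, h, rfl⟩ | ⟨h, rfl⟩ | ⟨h, rfl⟩
  · exact .push ⟨q', rfl, q, _, a, rfl, h, hm⟩
  · exact .pop ⟨q', rfl, q, _, a, rfl, h, hm⟩
  · exact .neutral (.inl ⟨q', rfl, q, _, a, rfl, h, hm⟩)

theorem product_step_cases {c c' : Option Q × P × P} {s s' : List Γ}
    (h : (M.product A).Step (c, s) (c', s')) :
    (∃ q q' h a, c.1 = some q ∧ c'.1 = some q' ∧ M.Act q h a s q' s' ∧ HeadMove A h a c.2 c'.2) ∨
      (M.Stuck A c s.head? c' ∧ s' = s) := by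
  cases h with
  | neutral h =>
    rcases h with ⟨q', h', q, h, a, hq, hr, hm⟩ | h
    · exact .inl ⟨q, q', h, a, hq, h', .inr (.inr ⟨hr, rfl⟩), hm⟩
    · exact .inr ⟨h, rfl⟩
  | push h =>
    obtain ⟨q', h', q, h, a, hq, hr, hm⟩ := h
    exact .inl ⟨q, q', h, a, hq, h', .inl ⟨_, hr, rfl⟩, hm⟩
  | pop h =>
    obtain ⟨q', h', q, h, a, hq, hr, hm⟩ := h
    exact .inl ⟨q, q', h, a, hq, h', .inr (.inl ⟨hr, rfl⟩), hm⟩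

/-- Either both heads face the same letter and the word is that letter alone, or `w'` is enclosed
between two blocked letters. -/
theorem Stuck.exists_word {c c' : Option Q × P × P} {s : List Γ} (h : M.Stuck A c s.head? c')
    {w' : List S} (hw' : A.evalFrom c'.2.1 w' = c'.2.2) :
    ∃ w, A.evalFrom c.2.1 w = c.2.2 ∧ ¬ M.AcceptsFrom c.1 w s := by
  obtain ⟨-, a, ha, hl, ⟨hr, hc, -⟩ | ⟨a', ha', hr⟩⟩ := h
  · refine ⟨[a], by rw [DFA.evalFrom_singleton, ha, hc],
      not_acceptsFrom_of_blocked (by simp) ?_⟩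
    rintro (_ | _) b v hv
    · obtain ⟨rfl, -⟩ := List.cons.inj hv
      exact hl
    -- Writing the word as an append lets the last letters be compared.
    · obtain ⟨-, ⟨⟩⟩ := List.append_inj' (show [] ++ [a] = v ++ [b] from hv) rfl
      exact hr
  · refine ⟨a :: (w' ++ [a']), ?_, not_acceptsFrom_of_blocked (by simp) ?_⟩
    · rw [DFA.evalFrom_cons, DFA.evalFrom_append_singleton, ha, hw', ha']
    · rintro (_ | _) b v hv
      · obtain ⟨rfl, -⟩ := List.cons.inj hv
        exact hl
      · obtain ⟨-, ⟨⟩⟩ := List.append_inj' (show (a :: w') ++ [a'] = v ++ [b] from hv) rfl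
        exact hr

/-- A computation of the product that ends with matching states of `A` comes from a word. -/
theorem exists_word_of_steps (hM : M.IsDeterministic) {x y : (Option Q × P × P) × List Γ}
    (h : (M.product A).Steps x y) (hy : y.1.2.1 = y.1.2.2) :
    ∃ w, A.evalFrom x.1.2.1 w = x.1.2.2 ∧
      (M.AcceptsFrom x.1.1 w x.2 ↔ M.AcceptingState y.1.1) := by
  -- The word is built backwards, from the empty word at the end of the computation.
  induction h using Relation.ReflTransGen.head_induction_on with
  | refl => exact ⟨[], hy, acceptsFrom_nil_iff⟩
  | @head x x' hs _ ih =>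
    obtain ⟨w', hw', hacc⟩ := ih
    obtain ⟨c, s⟩ := x
    obtain ⟨c', s'⟩ := x'
    rcases product_step_cases hs with ⟨q, q', h, a, hq, hq', hact, hm⟩ | ⟨h, -⟩
    · obtain ⟨w, hr, hw⟩ := hm.exists_reads hw'
      refine ⟨w, hw, ?_⟩
      simp only [hq, hq'] at hacc ⊢
      rw [acceptsFrom_iff_of_step hM (step_iff.2 ⟨a, hr, hact⟩), hacc]
    · obtain ⟨w, hw, hn⟩ := h.exists_word hw'
      -- An accepting final state would make the configuration after the stuck move accept, but that
      -- one has no state.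
      refine ⟨w, hw, iff_of_false hn fun hf => ?_⟩
      obtain ⟨q, hq, -⟩ := hacc.2 hf
      exact absurd (h.1.symm.trans hq) (by simp)

/-- Every word yields a computation of the product that ends with matching states of `A`. -/
theorem exists_steps_of_word (hM : M.IsDeterministic) (n : ℕ) :
    ∀ (w : List S), w.length ≤ n → ∀ (o : Option Q) (k : P × P) (s : List Γ),
      A.evalFrom k.1 w = k.2 →
      ∃ y : (Option Q × P × P) × List Γ, (M.product A).Steps ((o, k), s) y ∧
        y.1.2.1 = y.1.2.2 ∧ (M.AcceptsFrom o w s ↔ M.AcceptingState y.1.1) := by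
  -- The induction is on a bound for the length because a stuck move can remove two letters at once.
  induction n with
  | zero =>
    intro w hlen o k s hw
    obtain rfl := List.length_eq_zero_iff.1 (Nat.le_zero.1 hlen)
    exact ⟨_, .refl, hw, acceptsFrom_nil_iff⟩
  | succ n ih =>
    intro w hlen o k s hw
    rcases eq_or_ne w [] with rfl | hne
    · exact ⟨_, .refl, hw, acceptsFrom_nil_iff⟩
    by_cases hb : ∀ h a w', Head.Reads h a w w' → ¬ M.Enabled o h a s.head?
    · have hn := not_acceptsFrom_of_blocked hne hb
      obtain ⟨a, v, rfl⟩ := List.exists_cons_of_ne_nil hne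
      have hl := hb .left a v rfl
      rcases List.eq_nil_or_concat v with rfl | ⟨v, a', rfl⟩
      · rw [DFA.evalFrom_singleton] at hw
        refine ⟨((none, k.2, k.2), s), .single (.neutral (.inr ⟨rfl, a, hw, hl, .inl
          ⟨hb .right a [] rfl, rfl, rfl⟩⟩)), rfl, iff_of_false hn ?_⟩
        rintro ⟨q, -, ⟨⟩⟩
      · rw [List.concat_eq_append] at *
        rw [DFA.evalFrom_cons, DFA.evalFrom_append_singleton] at hw
        -- The inner word is processed without a state. Nothing is enabled then, so it is discarded
        -- by further stuck moves.
        obtain ⟨y, hy, hk, hacc⟩ := ih v (by simp at hlen; omega) none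
          (A.step k.1 a, A.evalFrom (A.step k.1 a) v) s rfl
        refine ⟨y, .head (.neutral (.inr ⟨rfl, a, rfl, hl, .inr ⟨a', hw, ?_⟩⟩)) hy, hk,
          iff_of_false hn fun hf => ?_⟩
        · exact hb .right a' (a :: v) rfl
        · obtain ⟨q, ⟨⟩, -⟩ := hacc.2 hf
    · push Not at hb
      obtain ⟨h, a, w', hr, hen⟩ := hb
      have hen' := hen
      obtain ⟨q, rfl, -⟩ := hen'
      -- Some head can read, and by determinism any such move is the right one to follow.
      obtain ⟨q', s', hact⟩ := enabled_some_iff.1 hen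
      obtain ⟨k', hm, hw'⟩ := hr.exists_headMove hw
      have hlen' : w'.length ≤ n := by
        cases h <;> simp only [Head.Reads] at hr <;> subst hr <;> simpa using hlen
      obtain ⟨y, hy, hk, hacc⟩ := ih w' hlen' (some q') k' s' hw'
      exact ⟨y, .head (product_step_of_act hact hm) hy, hk,
        (acceptsFrom_iff_of_step hM (step_iff.2 ⟨a, hr, hact⟩)).trans hacc⟩

theorem mem_language_iff {w : List S} :
    w ∈ M.language ↔ M.AcceptsFrom (some M.start) w [] := by
  constructor
  · rintro ⟨q, hq, s, h⟩
    exact ⟨_, rfl, q, hq, s, h⟩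
  · rintro ⟨_, ⟨⟩, q, hq, s, h⟩
    exact ⟨q, hq, s, h⟩

end Automaton

/-! ### Inclusions as the absence of counterexamples -/

section Decision

variable [FinEnum Q] [FinEnum S] [FinEnum Γ] [FinEnum P] {M : Automaton Q S Γ} {A : DFA S P}

theorem codeDiffers_iff_exists_word (hM : M.IsDeterministic) (b : Bool) :
    CodeDiffers b (M.code, dfaCode A) ↔
      ∃ w, (w ∈ A.accepts ↔ b = true) ∧ (w ∈ M.language ↔ ¬ b = true) := by
  rw [codeDiffers_iff]
  constructor
  · rintro ⟨⟨o, p, r⟩, ⟨ho, hp, hr⟩, c, s, hs, hc, hf⟩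
    simp only at ho hp hr
    subst ho hp
    obtain ⟨w, hw, hacc⟩ := Automaton.exists_word_of_steps hM hs hc
    refine ⟨w, ?_, Automaton.mem_language_iff.trans (hacc.trans hf)⟩
    rw [DFA.mem_accepts, DFA.eval, show A.evalFrom A.start w = r from hw, hr]
  · rintro ⟨w, hr, hf⟩
    -- The right guess for the second DFA state is the one reached on all of `w`.
    obtain ⟨y, hy, hk, hacc⟩ := Automaton.exists_steps_of_word (A := A) hM w.length w le_rfl
      (some M.start) (A.start, A.evalFrom A.start w) [] rfl
    exact ⟨(some M.start, A.start, A.evalFrom A.start w), ⟨rfl, rfl, hr⟩, y.1, y.2, hy, hk,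
      hacc.symm.trans (Automaton.mem_language_iff.symm.trans hf)⟩

theorem not_codeDiffers_true_iff (hM : M.IsDeterministic) :
    ¬ CodeDiffers true (M.code, dfaCode A) ↔ A.accepts ≤ M.language := by
  rw [codeDiffers_iff_exists_word hM]
  simp only [not_exists, not_and, iff_true, not_true_eq_false, iff_false, not_not]
  rfl

theorem not_codeDiffers_false_iff (hM : M.IsDeterministic) :
    ¬ CodeDiffers false (M.code, dfaCode A) ↔ M.language ≤ A.accepts := by
  rw [codeDiffers_iff_exists_word hM]
  simp only [not_exists, not_and, Bool.false_eq_true, iff_false, not_false_eq_true, iff_true]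
  exact forall_congr' fun w => not_imp_not

end Decision

theorem computablePred_not_codeDiffers (b : Bool) : ComputablePred fun x => ¬ CodeDiffers b x := by
  obtain ⟨_, h⟩ := (primrecPred_codeDiffers b).not
  exact ⟨_, h.to_comp⟩

theorem computablePred_not_codeDiffers_both :
    ComputablePred fun x => ¬ CodeDiffers false x ∧ ¬ CodeDiffers true x := by
  obtain ⟨_, h⟩ := (primrecPred_codeDiffers false).not.and (primrecPred_codeDiffers true).not
  exact ⟨_, h.to_comp⟩

end IDDHPDA

theorem mainTheorem7 :
    IDDHPDA.DecidableForRegular (fun L R => L = R) ∧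
    IDDHPDA.DecidableForRegular (fun L R => R ≤ L) ∧
    IDDHPDA.DecidableForRegular (fun L R => L ≤ R) := by
  refine ⟨⟨_, IDDHPDA.computablePred_not_codeDiffers_both, ?_⟩,
    ⟨_, IDDHPDA.computablePred_not_codeDiffers true, ?_⟩,
    ⟨_, IDDHPDA.computablePred_not_codeDiffers false, ?_⟩⟩
  · intro Q S Γ P _ _ _ _ M A hM
    exact (and_congr (IDDHPDA.not_codeDiffers_false_iff hM)
      (IDDHPDA.not_codeDiffers_true_iff hM)).trans le_antisymm_iff.symm
  · intro Q S Γ P _ _ _ _ M A hM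
    exact IDDHPDA.not_codeDiffers_true_iff hM
  · intro Q S Γ P _ _ _ _ M A hM
    exact IDDHPDA.not_codeDiffers_false_iff hM
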